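/- Let $d \ge 2$ and $0 \le \lambda < 2^{1-d}$. Let $r=r_d$ be the radius for which a ball in $\mathbb{R}^d$ has volume $1$, and write $|\cdot|$ for Lebesgue measure and $B_r(x)$ for the open ball. For a compact set $\Lambda\subset\mathbb{R}^d$ with $|\Lambda|>0$ put $\Lambda_{\mathrm{Int}}=\{x\in\Lambda:\mathrm{dist}(x,\Lambda^c)\ge r\}$. A boundary condition is a measurable set $\tau\subseteq\Lambda_{\mathrm{Int}}$, and $\Omega_\Lambda^\tau$ is the set of all finite subsets of $\Lambda_{\mathrm{Int}}\setminus\tau$ whose points are at pairwise distance at least $2r$, equipped with the $\sigma$-algebra generated by the numbers of points in Borel sets. The single-center dynamics on $\Omega_\Lambda^\tau$ at fugacity $\lambda$ is the Markov chain $(X_t)_{t\ge 0}$ in which $X_{t+1}$ is obtained from $X_t$ as follows: pick $x\in\Lambda$ uniformly at random; with probability $\frac{1}{1+\lambda}$ set $X_{t+1}=X_t\setminus B_r(x)$; with probability $\frac{\lambda}{1+\lambda}$ set $X_{t+1}=X_t\cup\{x\}$ if $X_t\cup\{x\}\in\Omega_\Lambda^\tau$, and $X_{t+1}=X_t$ otherwise.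 Then the single-center dynamics has optimal temporal mixing on $\mathbb{R}^d$ at fugacity $\lambda$. That is, there exist constants $b,c>0$, depending only on $d$ and $\lambda$, such that for every compact $\Lambda\subset\mathbb{R}^d$ of volume $n=|\Lambda|>0$, every boundary condition $\tau\subseteq\Lambda_{\mathrm{Int}}$, every real $s>0$, and any two instances $(X_t)$ and $(Y_t)$ of the single-center dynamics on $\Omega_\Lambda^\tau$ (with arbitrary initial distributions), the total variation distance between the laws of $X_{\lfloor sn\rfloor}$ and $Y_{\lfloor sn\rfloor}$ is at most $b\,n\,e^{-cs}$. -/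

import Mathlib

universe u

open MeasureTheory ProbabilityTheory
open scoped NNReal ENNReal

namespace HardSphere

noncomputable section

/-- `d`-dimensional Euclidean space. -/
abbrev E (d : ℕ) : Type := EuclideanSpace ℝ (Fin d)

/-- The radius `r = r_d` for which a ball of radius `r` in `ℝ^d` has volume one. -/
def radius (d : ℕ) : ℝ := (volume.real (Metric.ball (0 : E d) 1)) ^ (-(1 / (d : ℝ)))

theorem radius_pos (d : ℕ) : 0 < radius d :=
  Real.rpow_pos_of_pos (ENNReal.toReal_pos
    (Metric.measure_ball_pos volume (0 : E d) one_pos).ne' measure_ball_lt_top.ne) _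

/-- In dimension at least one, the balls of radius `radius d` have volume one. -/
theorem volume_ball_radius {d : ℕ} (hd : 1 ≤ d) (x : E d) :
    volume (Metric.ball x (radius d)) = 1 := by
  have hd0 : (d : ℝ) ≠ 0 := by positivity
  have hpos : 0 < volume.real (Metric.ball (0 : E d) 1) := ENNReal.toReal_pos
    (Metric.measure_ball_pos volume (0 : E d) one_pos).ne' measure_ball_lt_top.ne
  rw [Measure.addHaar_ball_of_pos volume x (radius_pos d), finrank_euclideanSpace_fin]
  have h : radius d ^ d = (volume.real (Metric.ball (0 : E d) 1))⁻¹ := by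
    rw [radius, ← Real.rpow_natCast, ← Real.rpow_mul hpos.le]
    have : -(1 / (d : ℝ)) * d = -1 := by field_simp
    rw [this, Real.rpow_neg_one]
  rw [h, ENNReal.ofReal_inv_of_pos hpos, measureReal_def,
    ENNReal.ofReal_toReal measure_ball_lt_top.ne]
  exact ENNReal.inv_mul_cancel (Metric.measure_ball_pos volume (0 : E d) one_pos).ne'
    measure_ball_lt_top.ne

/-- `Λ_Int`: the points of `Λ` at distance at least `r` from the complement of `Λ`. -/
def interiorRegion {d : ℕ} (Λ : Set (E d)) : Set (E d) :=
  {x | x ∈ Λ ∧ ENNReal.ofReal (radius d) ≤ Metric.infEDist x Λᶜ}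

/-- A finite set of centers is a configuration in `Λ` with boundary condition `τ` if it lies in
`Λ_Int \ τ` and its points are at pairwise distance at least `2r`. -/
def IsConfig {d : ℕ} (Λ τ : Set (E d)) (S : Finset (E d)) : Prop :=
  (S : Set (E d)) ⊆ interiorRegion Λ \ τ ∧
    (S : Set (E d)).Pairwise fun x y => 2 * radius d ≤ dist x y

/-- The state space `Ω_Λ^τ` of all configurations. -/
@[ext]
structure Config {d : ℕ} (Λ τ : Set (E d)) where
  /-- The set of centers. -/
  centers : Finset (E d)
  /-- The centers form an admissible configuration. -/
  isConfig : IsConfig Λ τ centers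

open Classical in
/-- The number of centers of a configuration in a set `A`. -/
def Config.count {d : ℕ} {Λ τ : Set (E d)} (A : Set (E d)) (X : Config Λ τ) : ℕ :=
  (X.centers.filter fun y => y ∈ A).card

/-- The usual `σ`-algebra of point configurations: the coarsest one for which the number of
points in every Borel set is measurable. -/
instance Config.instMeasurableSpace {d : ℕ} {Λ τ : Set (E d)} :
    MeasurableSpace (Config Λ τ) :=
  ⨆ A : {A : Set (E d) // MeasurableSet A}, MeasurableSpace.comap (Config.count A.1) ⊤

open Classical in
/-- The removal update at `x`: delete all centers at distance less than `r` from `x`. -/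
def removeAt {d : ℕ} {Λ τ : Set (E d)} (X : Config Λ τ) (x : E d) : Config Λ τ where
  centers := X.centers.filter fun y => y ∉ Metric.ball x (radius d)
  isConfig := by
    have h : ((X.centers.filter fun y => y ∉ Metric.ball x (radius d) : Finset (E d)) :
        Set (E d)) ⊆ X.centers := Finset.coe_subset.2 (Finset.filter_subset _ _)
    exact ⟨h.trans X.isConfig.1, X.isConfig.2.mono h⟩

open Classical in
/-- The addition update at `x`: add `x` as a center if the result is a configuration, and do
nothing otherwise. -/
def addAt {d : ℕ} {Λ τ : Set (E d)} (X : Config Λ τ) (x : E d) : Config Λ τ :=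
  if h : IsConfig Λ τ (X.centers ∪ {x}) then ⟨X.centers ∪ {x}, h⟩ else X

theorem Config.measurable_count {d : ℕ} {Λ τ A : Set (E d)} (hA : MeasurableSet A) :
    Measurable (Config.count (Λ := Λ) (τ := τ) A) := by
  have h : MeasurableSpace.comap (Config.count (Λ := Λ) (τ := τ) A) ⊤ ≤
      Config.instMeasurableSpace :=
    le_iSup (fun A : {A : Set (E d) // MeasurableSet A} =>
      MeasurableSpace.comap (Config.count (Λ := Λ) (τ := τ) A.1) ⊤) ⟨A, hA⟩
  exact (comap_measurable (Config.count (Λ := Λ) (τ := τ) A)).mono h le_rfl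

/-- A map into `Ω_Λ^τ` is measurable if all its counts are. -/
theorem Config.measurable_of_count {α : Type*} [MeasurableSpace α] {d : ℕ} {Λ τ : Set (E d)}
    {f : α → Config Λ τ}
    (h : ∀ A : Set (E d), MeasurableSet A → Measurable fun a => (f a).count A) :
    Measurable f := by
  rw [measurable_iff_comap_le, Config.instMeasurableSpace, MeasurableSpace.comap_iSup]
  refine iSup_le fun A => ?_
  rw [MeasurableSpace.comap_comp]
  exact (h A.1 A.2).comap_le

/-- Joint measurability of the number of centers in a measurably varying set. -/
theorem Config.measurable_count_section {β : Type*} [MeasurableSpace β] {d : ℕ}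
    {Λ τ : Set (E d)} {S : Set (E d × β)} (hS : MeasurableSet S) :
    Measurable fun p : Config Λ τ × β => p.1.count {y | (y, p.2) ∈ S} := by
  classical
  induction S, hS using MeasurableSpace.induction_on_inter generateFrom_prod.symm
    isPiSystem_prod with
  | empty => simp [Config.count]
  | basic S hS =>
    obtain ⟨A, hA, B, hB, rfl⟩ := hS
    have h : (fun p : Config Λ τ × β => p.1.count {y | (y, p.2) ∈ A ×ˢ B}) =
        fun p => if p.2 ∈ B then p.1.count A else 0 := by
      funext p
      by_cases hp : p.2 ∈ B <;> simp [Config.count, hp]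
    rw [h]
    exact Measurable.ite (measurable_snd hB)
      ((Config.measurable_count hA).comp measurable_fst) measurable_const
  | compl S hS ih =>
    have h : (fun p : Config Λ τ × β => p.1.count {y | (y, p.2) ∈ Sᶜ}) =
        fun p => p.1.count Set.univ - p.1.count {y | (y, p.2) ∈ S} := by
      funext p
      have := Finset.card_filter_add_card_filter_not (s := p.1.centers)
        (fun y => (y, p.2) ∈ S)
      simp only [Config.count, Set.mem_ofPred_eq, Set.mem_compl_iff, Set.mem_univ,
        Finset.filter_true]
      omega
    rw [h]
    exact ((Config.measurable_count MeasurableSet.univ).comp measurable_fst).sub ih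
  | iUnion f hd hf ih =>
    have h : (fun p : Config Λ τ × β =>
        ((p.1.count {y | (y, p.2) ∈ ⋃ i, f i} : ℕ) : ℝ≥0∞)) =
        fun p => ∑' i, ((p.1.count {y | (y, p.2) ∈ f i} : ℕ) : ℝ≥0∞) := by
      funext p
      simp only [Config.count, Set.mem_ofPred_eq, Finset.card_filter, Nat.cast_sum,
        Nat.cast_ite, Nat.cast_one, Nat.cast_zero]
      rw [Summable.tsum_finsetSum fun _ _ => ENNReal.summable]
      refine Finset.sum_congr rfl fun y _ => ?_
      by_cases hy : (y, p.2) ∈ ⋃ i, f i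
      · obtain ⟨i, hi⟩ := Set.mem_iUnion.1 hy
        rw [if_pos hy, tsum_eq_single i, if_pos hi]
        intro j hj
        exact if_neg fun h => Set.disjoint_left.1 (hd hj) h hi
      · rw [if_neg hy]
        simp only [Set.mem_iUnion, not_exists] at hy
        simp [hy]
    have hm : Measurable fun p : Config Λ τ × β =>
        ((p.1.count {y | (y, p.2) ∈ ⋃ i, f i} : ℕ) : ℝ≥0∞) := by
      rw [h]
      exact Measurable.tsum fun i => (measurable_from_top (f := fun n : ℕ =>
        (n : ℝ≥0∞))).comp (ih i)
    refine measurable_to_countable' fun n => ?_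
    have := hm (measurableSet_singleton (n : ℝ≥0∞))
    convert this using 1
    ext p
    simp

theorem measurableSet_interiorRegion {d : ℕ} {Λ : Set (E d)} (hΛ : MeasurableSet Λ) :
    MeasurableSet (interiorRegion Λ) :=
  hΛ.inter (measurableSet_le measurable_const Metric.continuous_infEDist.measurable)

theorem measurable_removeAt {d : ℕ} {Λ τ : Set (E d)} :
    Measurable fun p : Config Λ τ × E d => removeAt p.1 p.2 := by
  classical
  refine Config.measurable_of_count fun A hA => ?_
  have hS : MeasurableSet {q : E d × E d | q.1 ∈ A ∧ q.1 ∉ Metric.ball q.2 (radius d)} :=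
    (measurable_fst hA).inter (measurableSet_lt (measurable_fst.dist measurable_snd)
      measurable_const).compl
  convert Config.measurable_count_section (Λ := Λ) (τ := τ) hS using 2 with p
  simp only [Config.count, removeAt, Finset.filter_filter, Set.mem_ofPred_eq]
  congr 1
  ext y
  simp [and_comm]

open Classical in
/-- Whether `x` can be added to `X` is decided locally. -/
theorem isConfig_union_iff {d : ℕ} {Λ τ : Set (E d)} (X : Config Λ τ) (x : E d) :
    IsConfig Λ τ (X.centers ∪ {x}) ↔ x ∈ interiorRegion Λ \ τ ∧
      X.count {y | y ≠ x ∧ dist y x < 2 * radius d} = 0 := by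
  have : Std.Symm fun a b : E d => 2 * radius d ≤ dist a b :=
    ⟨fun a b hab => by rwa [dist_comm]⟩
  have h := X.isConfig
  simp only [IsConfig, Config.count, Finset.card_eq_zero, Finset.filter_eq_empty_iff,
    Set.mem_ofPred_eq, not_and, not_lt] at h ⊢
  rw [Finset.union_comm, Finset.singleton_union, Finset.coe_insert, Set.insert_subset_iff,
    Set.pairwise_insert_of_symm]
  constructor
  · rintro ⟨⟨h1, -⟩, -, h2⟩
    exact ⟨h1, fun y hy hne => by rw [dist_comm]; exact h2 y hy hne.symm⟩
  · rintro ⟨h1, h2⟩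
    exact ⟨⟨h1, h.1⟩, h.2, fun y hy hne => by rw [dist_comm]; exact h2 hy hne.symm⟩

theorem measurable_addAt {d : ℕ} {Λ τ : Set (E d)} (hΛ : MeasurableSet Λ)
    (hτ : MeasurableSet τ) :
    Measurable fun p : Config Λ τ × E d => addAt p.1 p.2 := by
  classical
  have hS : MeasurableSet {q : E d × E d | q.1 ≠ q.2 ∧ dist q.1 q.2 < 2 * radius d} :=
    (measurableSet_eq_fun measurable_fst measurable_snd).compl.inter
      (measurableSet_lt (measurable_fst.dist measurable_snd) measurable_const)
  have hG : MeasurableSet {p : Config Λ τ × E d | IsConfig Λ τ (p.1.centers ∪ {p.2})} := by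
    have : {p : Config Λ τ × E d | IsConfig Λ τ (p.1.centers ∪ {p.2})} =
        (Prod.snd ⁻¹' (interiorRegion Λ \ τ)) ∩
        (fun p : Config Λ τ × E d => p.1.count {y | (y, p.2) ∈
          {q : E d × E d | q.1 ≠ q.2 ∧ dist q.1 q.2 < 2 * radius d}}) ⁻¹' {0} := by
      ext p
      have := isConfig_union_iff p.1 p.2
      simp only [Set.mem_ofPred_eq, Set.mem_inter_iff, Set.mem_preimage,
        Set.mem_singleton_iff]
      convert this
    rw [this]
    exact (measurable_snd ((measurableSet_interiorRegion hΛ).diff hτ)).inter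
      (Config.measurable_count_section hS (measurableSet_singleton 0))
  refine Config.measurable_of_count fun A hA => ?_
  have hT : MeasurableSet {q : E d × E d | q.1 ∈ A ∧ q.1 ≠ q.2} :=
    (measurable_fst hA).inter (measurableSet_eq_fun measurable_fst measurable_snd).compl
  have h : (fun p : Config Λ τ × E d => (addAt p.1 p.2).count A) = fun p =>
      if p ∈ {p : Config Λ τ × E d | IsConfig Λ τ (p.1.centers ∪ {p.2})} then
        p.1.count {y | (y, p.2) ∈ {q : E d × E d | q.1 ∈ A ∧ q.1 ≠ q.2}} +
          (if p.2 ∈ A then 1 else 0)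
      else p.1.count A := by
    funext p
    by_cases hp : IsConfig Λ τ (p.1.centers ∪ {p.2})
    · rw [if_pos (by simpa using hp)]
      simp only [addAt, dif_pos hp, Config.count, Set.mem_ofPred_eq]
      have hu : (p.1.centers ∪ {p.2}).filter (fun y => y ∈ A) =
          (p.1.centers.filter fun y => y ∈ A ∧ y ≠ p.2) ∪
            (if p.2 ∈ A then {p.2} else ∅) := by
        ext y
        by_cases hy : y = p.2
        · subst hy
          by_cases hA : p.2 ∈ A <;> simp [hA]
        · by_cases hA : p.2 ∈ A <;> simp [hA, hy]
      rw [hu, Finset.card_union_of_disjoint]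
      · split_ifs <;> simp
      · split_ifs <;> simp
    · rw [if_neg (by simpa using hp)]
      simp only [addAt, dif_neg hp]
  rw [h]
  exact Measurable.ite hG ((Config.measurable_count_section hT).add
    (Measurable.ite (measurable_snd hA) measurable_const measurable_const))
    ((Config.measurable_count hA).comp measurable_fst)

/-- The law of one step of the single-center dynamics on `Ω_Λ^τ` at fugacity `lam`, started from
`X`: pick `x` uniformly in `Λ`; with probability `1 / (1 + lam)` remove the centers at distance
less than `r` from `x`, with probability `lam / (1 + lam)` attempt to add a center at `x`. -/
def stepLaw {d : ℕ} (lam : ℝ≥0) {Λ τ : Set (E d)} (X : Config Λ τ) : Measure (Config Λ τ) :=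
  ((1 / (1 + lam) : ℝ≥0) : ℝ≥0∞) • (volume[|Λ]).map (fun x => removeAt X x) +
  ((lam / (1 + lam) : ℝ≥0) : ℝ≥0∞) • (volume[|Λ]).map (fun x => addAt X x)

/-- The transition kernel of the single-center dynamics on `Ω_Λ^τ` at fugacity `lam`. -/
def singleCenterKernel {d : ℕ} (lam : ℝ≥0) (Λ τ : Set (E d)) (hΛ : MeasurableSet Λ)
    (hτ : MeasurableSet τ) : Kernel (Config Λ τ) (Config Λ τ) where
  toFun X := stepLaw lam X
  measurable' := by
    have key : ∀ F : Config Λ τ × E d → Config Λ τ, Measurable F →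
        Measurable fun X => (volume[|Λ]).map (fun x => F (X, x)) := by
      intro F hF
      refine Measure.measurable_of_measurable_coe _ fun s hs => ?_
      have h : ∀ X, (volume[|Λ]).map (fun x => F (X, x)) s =
          (volume[|Λ]) (Prod.mk X ⁻¹' (F ⁻¹' s)) := fun X =>
        Measure.map_apply (hF.comp measurable_prodMk_left) hs
      simp_rw [h]
      exact measurable_measure_prodMk_left (hF hs)
    refine Measure.measurable_of_measurable_coe _ fun s hs => ?_
    simp only [stepLaw, Measure.add_apply, Measure.smul_apply, smul_eq_mul]
    exact ((Measure.measurable_coe hs).comp (key _ measurable_removeAt)).const_mul _ |>.add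
      (((Measure.measurable_coe hs).comp (key _ (measurable_addAt hΛ hτ))).const_mul _)

/-- On regions of positive finite volume the transition probabilities have total mass one. -/
theorem isMarkovKernel_singleCenterKernel {d : ℕ} (lam : ℝ≥0) {Λ τ : Set (E d)}
    (hΛ : MeasurableSet Λ) (hτ : MeasurableSet τ) (h0 : volume Λ ≠ 0) (h1 : volume Λ ≠ ∞) :
    IsMarkovKernel (singleCenterKernel lam Λ τ hΛ hτ) := by
  refine ⟨fun X => ⟨?_⟩⟩
  have : IsProbabilityMeasure (volume[|Λ]) := cond_isProbabilityMeasure_of_finite h0 h1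
  have hr : Measurable fun x : E d => removeAt X x :=
    Measurable.of_uncurry_left (f := removeAt) measurable_removeAt
  have ha : Measurable fun x : E d => addAt X x :=
    Measurable.of_uncurry_left (f := addAt) (measurable_addAt hΛ hτ)
  have hX : singleCenterKernel lam Λ τ hΛ hτ X = stepLaw lam X := rfl
  rw [hX, stepLaw, Measure.add_apply, Measure.smul_apply, Measure.smul_apply, smul_eq_mul,
    smul_eq_mul, Measure.map_apply hr MeasurableSet.univ, Measure.map_apply ha MeasurableSet.univ,
    Set.preimage_univ, Set.preimage_univ, measure_univ, mul_one, mul_one]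
  rw [← ENNReal.coe_add, ← add_div, div_self (by positivity), ENNReal.coe_one]

/-- A (time-homogeneous) Markov chain `X_0, X_1, …` with transition kernel `κ` on a probability
space: given `X_0, …, X_t`, the conditional law of `X_{t+1}` is `κ(X_t, ·)`. -/
structure IsMarkovChain {S Ω : Type*} [MeasurableSpace S] [MeasurableSpace Ω] (κ : Kernel S S)
    (P : Measure Ω) (X : ℕ → Ω → S) : Prop where
  measurable (t : ℕ) : Measurable (X t)
  hasCondDistrib (t : ℕ) :
    HasCondDistrib (X (t + 1)) (fun ω (i : Finset.Iic t) => X i ω)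
      (κ.comap (fun h : Finset.Iic t → S => h ⟨t, Finset.mem_Iic.2 le_rfl⟩)
        (measurable_pi_apply _)) P

/-- The total variation distance of two probability measures. -/
def tvDist {S : Type*} [MeasurableSpace S] (μ ν : Measure S) : ℝ :=
  ⨆ A : {A : Set S // MeasurableSet A}, |μ.real A.1 - ν.real A.1|

/-- Optimal temporal mixing of the single-center dynamics on `ℝ^d` at fugacity `lam`: there are
`b, c > 0` such that for every compact region `Λ` of volume `n`, every boundary condition
`τ ⊆ Λ_Int`, every `s > 0` and any two instances `X`, `Y` of the dynamics, the laws of the states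
after `⌊s n⌋` steps are at total variation distance at most `b n exp (-c s)`. -/
def OptimalTemporalMixing (d : ℕ) (lam : ℝ≥0) : Prop :=
  ∃ b c : ℝ, 0 < b ∧ 0 < c ∧
    ∀ (Λ τ : Set (E d)) (hΛ : IsCompact Λ) (hτ : MeasurableSet τ),
      0 < volume Λ → τ ⊆ interiorRegion Λ →
    ∀ s : ℝ, 0 < s →
    ∀ (Ω₁ Ω₂ : Type u) [MeasurableSpace Ω₁] [MeasurableSpace Ω₂]
      (P : Measure Ω₁) (Q : Measure Ω₂) [IsProbabilityMeasure P] [IsProbabilityMeasure Q]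
      (X : ℕ → Ω₁ → Config Λ τ) (Y : ℕ → Ω₂ → Config Λ τ),
      IsMarkovChain (singleCenterKernel lam Λ τ hΛ.measurableSet hτ) P X →
      IsMarkovChain (singleCenterKernel lam Λ τ hΛ.measurableSet hτ) Q Y →
      tvDist (P.map (X ⌊s * volume.real Λ⌋₊)) (Q.map (Y ⌊s * volume.real Λ⌋₊)) ≤
        b * volume.real Λ * Real.exp (-c * s)

end

end HardSphere

/-! Run two copies of the dynamics with the same point `x` and the same coin. The number of
differing centers need not contract on its own, so it is combined with the volume of the
disagreement in what is blocked. Write `D` for the number of centers in exactly one of `X`, `Y`, and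
`M` for the volume of allowed points blocked in exactly one of them; the distance is `weight α X Y =
α D + M`. It is controlled for arbitrary pairs, not only for pairs differing in one center.

With `n` the volume of `Λ`, integrate over the update point `x ∈ Λ`. A removal step
(`integral_weight_removeAt_le`) gives at most `n (α D + M) - (α - 2 ^ d) D - 2 M`. An addition step
(`exists_weight_addAt_le`) gives at most `n (α D + M) + α M`: a new differing center can arise only
at a point blocked in exactly one copy, and the changes of the blocked volume cancel on average by
the symmetry of `dist x u < 2r`. Weighting additions by `λ`, both coefficients drift down once `2 ^
d < α` and `α λ < 2`; such an `α` exists exactly when `λ < 2 ^ (1 - d)`.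

Hence the Markov operator multiplies Lipschitz constants with respect to `weight` by at most `exp
(-c / n)` (`abs_integral_stepLaw_sub_le`). Iterating on indicators of events
(`abs_iterate_markovOp_sub_le`) bounds total variation, since `weight` is `O(n)`. -/

namespace HardSphere

open scoped Classical symmDiff

/-! ### Geometry of configurations and the weighted distance. -/

section Balls

variable {d : ℕ} {Λ τ : Set (E d)}

theorem measureReal_ball_radius (hd : 1 ≤ d) (x : E d) :
    volume.real (Metric.ball x (radius d)) = 1 := by
  simp [measureReal_def, volume_ball_radius hd x]

theorem measureReal_ball_two_mul_radius (hd : 1 ≤ d) (x : E d) :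
    volume.real (Metric.ball x (2 * radius d)) = 2 ^ d := by
  have : Nontrivial (E d) := Module.nontrivial_of_finrank_pos (R := ℝ) (by simp; omega)
  rw [measureReal_def, Measure.addHaar_ball_mul volume x zero_le_two, finrank_euclideanSpace_fin,
    volume_ball_radius hd, mul_one, ENNReal.toReal_ofReal (by positivity)]

/-- This is where the definition of `Λ_Int` enters: a full ball of volume one around each center
lies in `Λ`, so each center is deleted by a set of update points of volume exactly one. -/
theorem Config.ball_subset (X : Config Λ τ) {y : E d} (hy : y ∈ X.centers) :
    Metric.ball y (radius d) ⊆ Λ := by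
  intro z hz
  by_contra hzΛ
  have h := (X.isConfig.1 hy).1.2.trans (Metric.infEDist_le_edist_of_mem (y := z) hzΛ)
  rw [edist_dist, ENNReal.ofReal_le_ofReal_iff dist_nonneg, dist_comm] at h
  exact absurd hz (not_lt.2 h)

theorem Config.pairwiseDisjoint_ball (X : Config Λ τ) :
    (X.centers : Set (E d)).PairwiseDisjoint fun y => Metric.ball y (radius d) := by
  intro y hy z hz hne
  exact Metric.ball_disjoint_ball (by linarith [X.isConfig.2 hy hz hne])

theorem Config.measureReal_restrict_ball (hd : 1 ≤ d) (X : Config Λ τ) {y : E d}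
    (hy : y ∈ X.centers) : (volume.restrict Λ).real (Metric.ball y (radius d)) = 1 := by
  rw [measureReal_restrict_apply measurableSet_ball,
    Set.inter_eq_left.2 (X.ball_subset hy), measureReal_ball_radius hd]

theorem Config.card_le (hd : 1 ≤ d) (hfin : volume Λ ≠ ∞) (X : Config Λ τ) :
    (X.centers.card : ℝ) ≤ volume.real Λ := by
  have h := measureReal_biUnion_finset (μ := (volume : Measure (E d))) X.pairwiseDisjoint_ball
    (fun _ _ => measurableSet_ball) (fun _ _ => measure_ball_lt_top.ne)
  rw [Finset.sum_congr rfl fun y _ => measureReal_ball_radius hd y] at h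
  simp only [Finset.sum_const, nsmul_eq_mul, mul_one] at h
  rw [← h]
  exact measureReal_mono (Set.iUnion₂_subset fun y hy => X.ball_subset hy) hfin

/-- The region in which the centers of a configuration may lie. -/
def allowed (Λ τ : Set (E d)) : Set (E d) := interiorRegion Λ \ τ

theorem allowed_subset : allowed Λ τ ⊆ Λ := fun _ h => h.1.1

theorem measurableSet_allowed (hΛ : MeasurableSet Λ) (hτ : MeasurableSet τ) :
    MeasurableSet (allowed Λ τ) :=
  (measurableSet_interiorRegion hΛ).diff hτ

/-- The points at distance less than `2r` from a center in `S`. -/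
def blocked (S : Finset (E d)) : Set (E d) := {u | ∃ y ∈ S, dist u y < 2 * radius d}

theorem measurableSet_blocked (S : Finset (E d)) : MeasurableSet (blocked S) := by
  have : blocked S = ⋃ y ∈ S, Metric.ball y (2 * radius d) := by
    ext u; simp [blocked]
  rw [this]
  exact Finset.measurableSet_biUnion _ fun _ _ => measurableSet_ball

theorem blocked_insert (S : Finset (E d)) (x : E d) :
    blocked (insert x S) = Metric.ball x (2 * radius d) ∪ blocked S := by
  ext u; simp [blocked]

/-- The distance of two configurations: the number of centers in which they differ, weighted by
`α`, plus the volume of the allowed region that is blocked in exactly one of them. -/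
noncomputable def weight (α : ℝ) (X Y : Config Λ τ) : ℝ :=
  α * (X.centers ∆ Y.centers).card +
    (volume.restrict (allowed Λ τ)).real (blocked X.centers ∆ blocked Y.centers)

end Balls

/-! ### Fubini for sections, and deletion estimates for families of unit sets. -/

section Measure

variable {α β ι : Type*} [MeasurableSpace α] [MeasurableSpace β]

theorem integrable_measureReal_section {μ : Measure α} {ν : Measure β} [IsFiniteMeasure μ]
    [IsFiniteMeasure ν] {T : Set (α × β)} (hT : MeasurableSet T) :
    Integrable (fun x => ν.real {u | (x, u) ∈ T}) μ := by
  refine Integrable.of_bound (C := ν.real Set.univ)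
    (measurable_measure_prodMk_left hT).ennreal_toReal.aestronglyMeasurable
    (ae_of_all _ fun x => ?_)
  rw [Real.norm_of_nonneg measureReal_nonneg]
  exact measureReal_mono (Set.subset_univ _)

theorem integral_measureReal_section_swap {μ : Measure α} {ν : Measure β} [IsFiniteMeasure μ]
    [IsFiniteMeasure ν] {T : Set (α × β)} (hT : MeasurableSet T) :
    ∫ x, ν.real {u | (x, u) ∈ T} ∂μ = ∫ u, μ.real {x | (x, u) ∈ T} ∂ν := by
  have h := integral_integral_swap (μ := μ) (ν := ν)
    (f := fun x u => T.indicator (fun _ => (1 : ℝ)) (x, u))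
    ((integrable_const (1 : ℝ)).indicator hT)
  have h1 : ∀ x, ∫ u, T.indicator (fun _ => (1 : ℝ)) (x, u) ∂ν = ν.real {u | (x, u) ∈ T} := by
    intro x
    have : MeasurableSet {u | (x, u) ∈ T} := measurable_prodMk_left hT
    rw [← integral_indicator_one this]
    rfl
  have h2 : ∀ u, ∫ x, T.indicator (fun _ => (1 : ℝ)) (x, u) ∂μ = μ.real {x | (x, u) ∈ T} := by
    intro u
    have : MeasurableSet {x | (x, u) ∈ T} := measurable_prodMk_right hT
    rw [← integral_indicator_one this]
    rfl
  simpa only [h1, h2] using h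

/-- A single set loses its own unit of measure, and with `B.card = 1` this is an equality. With two
or more sets the term `B.card` alone pays for the `2`. This `2` becomes the factor in the
contraction of the blocked volume. -/
theorem measureReal_exists_notMem_le {μ : Measure α} [IsFiniteMeasure μ] {B : Finset ι}
    {b : ι → Set α} (hm : ∀ i, MeasurableSet (b i)) (h1 : ∀ i ∈ B, μ.real (b i) = 1)
    (hB : B.Nonempty) :
    μ.real {x | ∃ i ∈ B, x ∉ b i} + 2 ≤ μ.real Set.univ + B.card := by
  obtain ⟨v, rfl⟩ | h := hB.exists_eq_singleton_or_nontrivial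
  · have : {x | ∃ i ∈ ({v} : Finset ι), x ∉ b i} = (b v)ᶜ := by ext; simp
    rw [this, measureReal_compl (hm v), h1 v (by simp)]
    simp; linarith
  · have h2 : (2 : ℝ) ≤ B.card := by exact_mod_cast Finset.one_lt_card_iff_nontrivial.2 h
    linarith [measureReal_mono (μ := μ) (Set.subset_univ {x | ∃ i ∈ B, x ∉ b i})]

theorem measureReal_forall_mem_le {μ : Measure α} [IsFiniteMeasure μ] {A : Finset ι}
    {b : ι → Set α} (h1 : ∀ i ∈ A, μ.real (b i) = 1) (hA : A.Nonempty) :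
    μ.real {x | ∀ i ∈ A, x ∈ b i} ≤ 1 := by
  obtain ⟨v, hv⟩ := hA
  rw [← h1 v hv]
  exact measureReal_mono fun x hx => hx v hv

/-- Two families of disjoint unit sets: the measure of the points that empty exactly one of the
families by deleting the members through them. -/
theorem measureReal_xor_exists_notMem_le {μ : Measure α} [IsFiniteMeasure μ] [DecidableEq ι] {A B : Finset ι}
    {b : ι → Set α} (h1 : ∀ i ∈ A ∪ B, μ.real (b i) = 1)
    (dA : (A : Set ι).PairwiseDisjoint b) (dB : (B : Set ι).PairwiseDisjoint b)
    (hA : A.Nonempty) (hB : B.Nonempty) :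
    μ.real {x | Xor (∃ i ∈ A, x ∉ b i) (∃ i ∈ B, x ∉ b i)} ≤ (A ∆ B).card := by
  have hA1 : ∀ i ∈ A, μ.real (b i) = 1 := fun i hi => h1 i (Finset.mem_union_left _ hi)
  have hB1 : ∀ i ∈ B, μ.real (b i) = 1 := fun i hi => h1 i (Finset.mem_union_right _ hi)
  have key : ∀ {C : Finset ι}, (C : Set ι).PairwiseDisjoint b → C.Nontrivial →
      ∀ x, ∃ i ∈ C, x ∉ b i := by
    intro C dC ⟨i, hi, j, hj, hij⟩ x
    by_contra! h
    exact Set.disjoint_left.1 (dC hi hj hij) (h i hi) (h j hj)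
  by_cases hAB : A = B
  · subst hAB; simp [xor_self]
  have hcard : 1 ≤ ((A ∆ B).card : ℝ) := by
    have : (A ∆ B).Nonempty := by
      rw [Finset.nonempty_iff_ne_empty]
      exact fun h => hAB (symmDiff_eq_bot.1 h)
    exact_mod_cast this.card_pos
  obtain ⟨v, rfl⟩ | hA2 := hA.exists_eq_singleton_or_nontrivial
  · obtain ⟨w, rfl⟩ | hB2 := hB.exists_eq_singleton_or_nontrivial
    · have hvw : v ≠ w := fun h => hAB (by rw [h])
      have h2 : (({v} : Finset ι) ∆ {w}).card = 2 := by
        have : ({v} : Finset ι) ∆ {w} = {v, w} := by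
          ext i; simp only [Finset.mem_symmDiff, Finset.mem_singleton, Finset.mem_insert]
          grind
        rw [this, Finset.card_pair hvw]
      rw [h2]
      calc _ ≤ μ.real (b v ∪ b w) := measureReal_mono (by
            intro x hx
            simp only [Set.mem_ofPred_eq, Finset.mem_singleton, exists_eq_left] at hx
            simp only [Set.mem_union]
            rcases hx with h | h <;> tauto)
        _ ≤ _ := (measureReal_union_le _ _).trans (by
            rw [hA1 v (by simp), hB1 w (by simp)]; norm_num)
    · refine (measureReal_mono fun x hx => ?_).trans
        ((measureReal_forall_mem_le hA1 hA).trans hcard)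
      have := key dB hB2 x
      rcases hx with h | h
      · exact absurd this h.2
      · have := h.2; push Not at this; exact this
  · refine (measureReal_mono fun x hx => ?_).trans
        ((measureReal_forall_mem_le hB1 hB).trans hcard)
    have := key dA hA2 x
    rcases hx with h | h
    · have := h.2; push Not at this; exact this
    · exact absurd this h.2

end Measure

/-! ### Drift of the distance under removal updates. -/

section Removal

variable {d : ℕ} {Λ τ : Set (E d)}

/-- Takes the viewpoint of a fixed `u`: it stays blocked unless the update point `x` lies in the
`r`-ball of every center near `u`. This reduces the blocked volume to families of disjoint unit
balls. -/
theorem mem_blocked_removeAt {X : Config Λ τ} {x u : E d} :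
    u ∈ blocked (removeAt X x).centers ↔
      ∃ y ∈ X.centers.filter (fun y => dist u y < 2 * radius d),
        x ∉ Metric.ball y (radius d) := by
  simp only [blocked, removeAt, Set.mem_ofPred_eq, Finset.mem_filter, Metric.mem_ball]
  constructor
  · rintro ⟨y, ⟨h1, h2⟩, h3⟩
    exact ⟨y, ⟨h1, h3⟩, by rwa [dist_comm]⟩
  · rintro ⟨y, ⟨h1, h2⟩, h3⟩
    exact ⟨y, ⟨h1, by rwa [dist_comm]⟩, h2⟩

theorem mem_blocked_iff_filter_nonempty {S : Finset (E d)} {u : E d} :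
    u ∈ blocked S ↔ (S.filter fun y => dist u y < 2 * radius d).Nonempty := by
  simp [blocked, Finset.Nonempty]

theorem card_symmDiff_removeAt (X Y : Config Λ τ) (x : E d) :
    (((removeAt X x).centers ∆ (removeAt Y x).centers).card : ℝ) =
      (X.centers ∆ Y.centers).card - ∑ y ∈ X.centers ∆ Y.centers,
        (Metric.ball y (radius d)).indicator (fun _ => (1 : ℝ)) x := by
  have : (removeAt X x).centers ∆ (removeAt Y x).centers =
      (X.centers ∆ Y.centers).filter fun y => ¬ x ∈ Metric.ball y (radius d) := by
    ext y
    simp only [removeAt, Finset.mem_symmDiff, Finset.mem_filter, Metric.mem_ball, dist_comm y x]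
    tauto
  rw [this, eq_sub_iff_add_eq, ← Finset.card_filter_add_card_filter_not
    (s := X.centers ∆ Y.centers) (fun y => x ∈ Metric.ball y (radius d))]
  simp only [Set.indicator_apply, Finset.sum_boole]
  push_cast; ring

/-- The form ready for integration over `u`: a point of disagreement contributes at most `n - 2`
plus the number of nearby differing centers, any other point at most the latter number. -/
theorem measureReal_blocked_removeAt_le (hd : 1 ≤ d) (hfin : volume Λ ≠ ∞) (X Y : Config Λ τ)
    (u : E d) :
    (volume.restrict Λ).real
        {x | u ∈ blocked (removeAt X x).centers ∆ blocked (removeAt Y x).centers} +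
      (2 - volume.real Λ) * (blocked X.centers ∆ blocked Y.centers).indicator (fun _ => 1) u ≤
      ∑ y ∈ X.centers ∆ Y.centers,
        (Metric.ball y (2 * radius d)).indicator (fun _ => (1 : ℝ)) u := by
  have : IsFiniteMeasure (volume.restrict Λ) := ⟨by simpa using hfin.lt_top⟩
  set A := X.centers.filter fun y => dist u y < 2 * radius d with hA
  set B := Y.centers.filter fun y => dist u y < 2 * radius d with hB
  have hset : {x | u ∈ blocked (removeAt X x).centers ∆ blocked (removeAt Y x).centers} =
      {x | Xor (∃ y ∈ A, x ∉ Metric.ball y (radius d))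
        (∃ y ∈ B, x ∉ Metric.ball y (radius d))} := by
    ext x
    simp only [Set.mem_symmDiff, Set.mem_ofPred_eq, mem_blocked_removeAt, xor_def, hA, hB]
  have hsum : ∑ y ∈ X.centers ∆ Y.centers,
      (Metric.ball y (2 * radius d)).indicator (fun _ => (1 : ℝ)) u = (A ∆ B).card := by
    simp only [Set.indicator_apply, Finset.sum_boole, Metric.mem_ball]
    congr 2
    ext y
    simp only [hA, hB, Finset.mem_symmDiff, Finset.mem_filter]
    tauto
  have hn : (volume.restrict Λ).real Set.univ = volume.real Λ := by simp [measureReal_def]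
  have hA1 : ∀ y ∈ A, (volume.restrict Λ).real (Metric.ball y (radius d)) = 1 := fun y hy =>
    X.measureReal_restrict_ball hd (Finset.mem_filter.1 hy).1
  have hB1 : ∀ y ∈ B, (volume.restrict Λ).real (Metric.ball y (radius d)) = 1 := fun y hy =>
    Y.measureReal_restrict_ball hd (Finset.mem_filter.1 hy).1
  have dA : (A : Set (E d)).PairwiseDisjoint fun y => Metric.ball y (radius d) :=
    X.pairwiseDisjoint_ball.subset (Finset.coe_subset.2 (Finset.filter_subset _ _))
  have dB : (B : Set (E d)).PairwiseDisjoint fun y => Metric.ball y (radius d) :=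
    Y.pairwiseDisjoint_ball.subset (Finset.coe_subset.2 (Finset.filter_subset _ _))
  rw [hset, hsum, Set.indicator_apply, Set.mem_symmDiff, mem_blocked_iff_filter_nonempty,
    mem_blocked_iff_filter_nonempty, ← hA, ← hB]
  rcases A.eq_empty_or_nonempty with h0 | hA0 <;> rcases B.eq_empty_or_nonempty with h0' | hB0
  · simp [h0, h0', Xor]
  -- Only `Y` blocks `u`, so all centers of `Y` near `u` are differing centers, and `u` stays a
  -- disagreement unless all of them are deleted.
  · have := measureReal_exists_notMem_le (fun y => measurableSet_ball) hB1 hB0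
    rw [hn] at this
    have hs : (∅ : Finset (E d)) ∆ B = B := bot_symmDiff B
    simp [h0, hB0, hs, Xor] at this ⊢
    linarith
  · have := measureReal_exists_notMem_le (fun y => measurableSet_ball) hA1 hA0
    rw [hn] at this
    have hs : A ∆ (∅ : Finset (E d)) = A := symmDiff_bot A
    simp [h0', hA0, hs, Xor] at this ⊢
    linarith
  -- Both configurations block `u`: a disagreement is created only if `x` unblocks `u` in exactly
  -- one of them.
  · have := measureReal_xor_exists_notMem_le
      (fun y hy => (Finset.mem_union.1 hy).elim (hA1 y) (hB1 y)) dA dB hA0 hB0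
    simpa [hA0, hB0] using this

theorem measurableSet_blocked_removeAt (X Y : Config Λ τ) :
    MeasurableSet {p : E d × E d |
      p.2 ∈ blocked (removeAt X p.1).centers ∆ blocked (removeAt Y p.1).centers} := by
  have key : ∀ Z : Config Λ τ, MeasurableSet {p : E d × E d |
      p.2 ∈ blocked (removeAt Z p.1).centers} := by
    intro Z
    have : {p : E d × E d | p.2 ∈ blocked (removeAt Z p.1).centers} = ⋃ y ∈ Z.centers,
        (Metric.ball y (radius d))ᶜ ×ˢ Metric.ball y (2 * radius d) := by
      ext p
      simp only [Set.mem_ofPred_eq, mem_blocked_removeAt, Set.mem_iUnion, Set.mem_prod,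
        Finset.mem_filter, Set.mem_compl_iff, exists_prop]
      constructor
      · rintro ⟨y, ⟨h1, h2⟩, h3⟩; exact ⟨y, h1, h3, h2⟩
      · rintro ⟨y, h1, h3, h2⟩; exact ⟨y, ⟨h1, h2⟩, h3⟩
    rw [this]
    exact Finset.measurableSet_biUnion _ fun _ _ => measurableSet_ball.compl.prod measurableSet_ball
  exact (key X).symmDiff (key Y)

theorem integral_weight_removeAt_le (hd : 1 ≤ d) (hfin : volume Λ ≠ ∞)
    (α : ℝ) (X Y : Config Λ τ) :
    Integrable (fun x => weight α (removeAt X x) (removeAt Y x)) (volume.restrict Λ) ∧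
    ∫ x in Λ, weight α (removeAt X x) (removeAt Y x) ≤ volume.real Λ * weight α X Y -
      (α - 2 ^ d) * (X.centers ∆ Y.centers).card - 2 *
        (volume.restrict (allowed Λ τ)).real (blocked X.centers ∆ blocked Y.centers) := by
  have : IsFiniteMeasure (volume.restrict Λ) := ⟨by simpa using hfin.lt_top⟩
  have : IsFiniteMeasure (volume.restrict (allowed Λ τ)) :=
    ⟨by simpa using (measure_mono allowed_subset).trans_lt hfin.lt_top⟩
  set D := X.centers ∆ Y.centers with hD
  set M := blocked X.centers ∆ blocked Y.centers with hM
  have hMm : MeasurableSet M := (measurableSet_blocked _).symmDiff (measurableSet_blocked _)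
  have hT := measurableSet_blocked_removeAt X Y
  have hi0 : Integrable (fun _ : E d => (D.card : ℝ)) (volume.restrict Λ) := integrable_const _
  have hib : ∀ (ν : Measure (E d)) [IsFiniteMeasure ν] (ρ : ℝ) (y : E d), Integrable
      ((Metric.ball y ρ).indicator (fun _ => (1 : ℝ))) ν :=
    fun ν _ ρ y => (integrable_const _).indicator measurableSet_ball
  have hi1 : Integrable (fun x => ∑ y ∈ D, (Metric.ball y (radius d)).indicator
      (fun _ => (1 : ℝ)) x) (volume.restrict Λ) :=
    integrable_finsetSum _ fun y _ => hib _ _ y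
  have hi2 := integrable_measureReal_section (μ := volume.restrict Λ)
    (ν := volume.restrict (allowed Λ τ)) hT
  have hw : (fun x => weight α (removeAt X x) (removeAt Y x)) = fun x =>
      α * ((D.card : ℝ) - ∑ y ∈ D, (Metric.ball y (radius d)).indicator (fun _ => (1 : ℝ)) x) +
      (volume.restrict (allowed Λ τ)).real {u | (x, u) ∈ {p : E d × E d |
        p.2 ∈ blocked (removeAt X p.1).centers ∆ blocked (removeAt Y p.1).centers}} := by
    funext x
    rw [weight, card_symmDiff_removeAt]
    rfl
  have hi01 : Integrable (fun x => α * ((D.card : ℝ) - ∑ y ∈ D,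
      (Metric.ball y (radius d)).indicator (fun _ => (1 : ℝ)) x)) (volume.restrict Λ) :=
    (hi0.sub hi1).const_mul α
  refine ⟨by rw [hw]; exact hi01.add hi2, ?_⟩
  -- The blocked volume is integrated in the other order, `x` first for fixed `u`, so that the
  -- pointwise bound in `u` applies.
  rw [hw, integral_add hi01 hi2, integral_const_mul, integral_sub hi0 hi1,
    integral_finsetSum _ (fun y _ => hib _ _ y), integral_measureReal_section_swap hT]
  have hD1 : ∑ y ∈ D, ∫ x in Λ, (Metric.ball y (radius d)).indicator (fun _ => (1 : ℝ)) x =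
      D.card := by
    rw [Finset.sum_congr rfl (g := fun _ => (1 : ℝ))]
    · simp
    · intro y hy
      have h := integral_indicator_one (μ := volume.restrict Λ)
        (measurableSet_ball (x := y) (ε := radius d))
      refine h.trans ?_
      rcases Finset.mem_symmDiff.1 hy with h | h
      · exact X.measureReal_restrict_ball hd h.1
      · exact Y.measureReal_restrict_ball hd h.1
  -- Each differing center lies within `2r` of a set of points `u` of volume at most `2 ^ d`; this
  -- is the source of the threshold `2 ^ d < α`.
  have hD2 : ∫ u in allowed Λ τ, ∑ y ∈ D, (Metric.ball y (2 * radius d)).indicator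
      (fun _ => (1 : ℝ)) u ≤ 2 ^ d * D.card := by
    rw [integral_finsetSum _ (fun y _ => hib _ _ y), mul_comm (2 ^ d : ℝ), ← nsmul_eq_mul]
    refine Finset.sum_le_card_nsmul _ _ _ fun y _ => ?_
    refine (integral_indicator_one (μ := volume.restrict (allowed Λ τ))
      (measurableSet_ball (x := y) (ε := 2 * radius d))).trans_le ?_
    rw [← measureReal_ball_two_mul_radius hd y, measureReal_restrict_apply measurableSet_ball]
    exact measureReal_mono Set.inter_subset_left measure_ball_lt_top.ne
  have hi3 := integrable_measureReal_section (μ := volume.restrict (allowed Λ τ))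
    (ν := volume.restrict Λ) (measurable_swap hT)
  have hi4 : Integrable (M.indicator (fun _ => (1 : ℝ))) (volume.restrict (allowed Λ τ)) :=
    (integrable_const _).indicator hMm
  have hmain := integral_mono (hi3.add (hi4.const_mul (2 - volume.real Λ)))
    (integrable_finsetSum D fun y _ => hib (volume.restrict (allowed Λ τ)) (2 * radius d) y)
    (fun u => measureReal_blocked_removeAt_le hd hfin X Y u)
  have hM1 : ∫ u in allowed Λ τ, M.indicator (fun _ => (1 : ℝ)) u =
      (volume.restrict (allowed Λ τ)).real M := integral_indicator_one hMm
  simp only [Pi.add_apply] at hmain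
  rw [integral_add hi3 (hi4.const_mul _), integral_const_mul, hM1] at hmain
  rw [hD1, integral_const]
  simp only [measureReal_restrict_apply_univ, smul_eq_mul, weight, ← hD, ← hM]
  simp only [Set.mem_preimage, Prod.swap, Set.mem_ofPred_eq] at hmain
  have h3 := hmain.trans hD2
  simp only [Set.mem_ofPred_eq]
  linarith

end Removal

/-! ### Drift of the distance under addition updates. -/

section Addition

variable {d : ℕ} {Λ τ : Set (E d)}

theorem centers_addAt (X : Config Λ τ) (x : E d) :
    (addAt X x).centers =
      if x ∈ allowed Λ τ ∧ x ∉ blocked X.centers then insert x X.centers else X.centers := by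
  -- A center blocks itself in the sense of `blocked`, whereas `isConfig_union_iff` ignores `y = x`.
  -- The two criteria differ when `x` is already a center, but adding `x` then changes nothing.
  by_cases hx : x ∈ X.centers
  · have hb : x ∈ blocked X.centers := ⟨x, hx, by simp [radius_pos d]⟩
    rw [if_neg (fun h => h.2 hb), addAt]
    split_ifs with h
    · ext y
      simp only [Finset.mem_union, Finset.mem_singleton]
      exact ⟨fun h => h.elim id fun h => h ▸ hx, Or.inl⟩
    · rfl
  · have hiff : IsConfig Λ τ (X.centers ∪ {x}) ↔ x ∈ allowed Λ τ ∧ x ∉ blocked X.centers := by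
      rw [isConfig_union_iff]
      simp only [Config.count, Finset.card_eq_zero, Finset.filter_eq_empty_iff, blocked,
        Set.mem_ofPred_eq, not_exists, not_and, allowed]
      refine and_congr_right fun _ => forall₂_congr fun y hy => ?_
      rw [dist_comm y x]
      exact ⟨fun h => h fun hyx => hx (hyx ▸ hy), fun h _ => h⟩
    by_cases h : IsConfig Λ τ (X.centers ∪ {x})
    · rw [if_pos (hiff.1 h), addAt, dif_pos h]
      ext y; simp
    · rw [if_neg (fun h' => h (hiff.2 h')), addAt, dif_neg h]

theorem card_symmDiff_addAt_le (X Y : Config Λ τ) (x : E d) :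
    (((addAt X x).centers ∆ (addAt Y x).centers).card : ℝ) ≤ (X.centers ∆ Y.centers).card +
      (allowed Λ τ).indicator
        ((blocked X.centers ∆ blocked Y.centers).indicator fun _ => (1 : ℝ)) x := by
  rw [centers_addAt, centers_addAt]
  have hmono : ∀ S : Finset (E d), S ⊆ insert x (X.centers ∆ Y.centers) →
      (S.card : ℝ) ≤ (X.centers ∆ Y.centers).card + 1 := fun S hS => by
    exact_mod_cast (Finset.card_le_card hS).trans (Finset.card_insert_le _ _)
  by_cases hL : x ∈ allowed Λ τ <;> by_cases hX : x ∈ blocked X.centers <;>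
    by_cases hY : x ∈ blocked Y.centers <;>
    simp only [hL, hX, hY, Set.indicator_apply, Set.mem_symmDiff, if_true, if_false, and_true,
      and_false, not_true_eq_false, not_false_eq_true, or_false,
      false_or, or_self, add_zero, le_refl]
  · refine hmono _ fun y => ?_
    simp only [Finset.mem_symmDiff, Finset.mem_insert]; tauto
  · refine hmono _ fun y => ?_
    simp only [Finset.mem_symmDiff, Finset.mem_insert]; tauto
  · refine Nat.cast_le.2 (Finset.card_le_card fun y => ?_)
    simp only [Finset.mem_symmDiff, Finset.mem_insert]; tauto

/-- Both a gain and a loss are recorded. If `x` is blocked in one copy only, the other copy gains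
the ball around `x`, and new disagreement appears only where neither copy blocked before. If `x` is
blocked in neither, both copies gain the ball, and all disagreement inside it disappears. -/
theorem measureReal_blocked_addAt_le {ν : Measure (E d)} [IsFiniteMeasure ν] (X Y : Config Λ τ)
    (x : E d) :
    ν.real (blocked (addAt X x).centers ∆ blocked (addAt Y x).centers) +
      (allowed Λ τ).indicator ((blocked X.centers ∪ blocked Y.centers)ᶜ.indicator fun x =>
        ν.real (Metric.ball x (2 * radius d) ∩ (blocked X.centers ∆ blocked Y.centers))) x ≤
    ν.real (blocked X.centers ∆ blocked Y.centers) +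
      (allowed Λ τ).indicator ((blocked X.centers ∆ blocked Y.centers).indicator fun x =>
        ν.real (Metric.ball x (2 * radius d) ∩ (blocked X.centers ∪ blocked Y.centers)ᶜ)) x := by
  rw [centers_addAt, centers_addAt]
  have hmono : ∀ S : Set (E d), S ⊆ (blocked X.centers ∆ blocked Y.centers) ∪
      (Metric.ball x (2 * radius d) ∩ (blocked X.centers ∪ blocked Y.centers)ᶜ) →
      ν.real S ≤ ν.real (blocked X.centers ∆ blocked Y.centers) +
        ν.real (Metric.ball x (2 * radius d) ∩ (blocked X.centers ∪ blocked Y.centers)ᶜ) :=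
    fun S hS => (measureReal_mono hS).trans (measureReal_union_le _ _)
  by_cases hL : x ∈ allowed Λ τ <;> by_cases hX : x ∈ blocked X.centers <;>
    by_cases hY : x ∈ blocked Y.centers <;>
    simp only [hL, hX, hY, Set.indicator_apply, Set.mem_symmDiff, Set.mem_compl_iff, Set.mem_union,
      if_true, if_false, and_true, and_false, not_true_eq_false,
      not_false_eq_true, or_false, or_self, or_true, add_zero, le_refl,
      blocked_insert]
  · refine hmono _ fun y => ?_
    simp only [Set.mem_symmDiff, Set.mem_union, Set.mem_inter_iff, Set.mem_compl_iff]; tauto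
  · refine hmono _ fun y => ?_
    simp only [Set.mem_symmDiff, Set.mem_union, Set.mem_inter_iff, Set.mem_compl_iff]; tauto
  -- The case where both copies accept `x`: the disagreement inside the ball is removed.
  · rw [← measureReal_inter_add_sdiff (s := blocked X.centers ∆ blocked Y.centers)
      (measurableSet_ball (x := x) (ε := 2 * radius d)), add_comm, Set.inter_comm]
    refine add_le_add le_rfl (measureReal_mono fun y => ?_)
    simp only [Set.mem_symmDiff, Set.mem_union, Set.mem_sdiff]; tauto

/-- Both sides measure the pairs in `G × M` at distance less than `ρ`. With `G` the points blocked
in neither copy and `M` those blocked in exactly one, the average loss and gain of an addition step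
coincide. -/
theorem integral_indicator_measureReal_ball_inter_comm {ν : Measure (E d)} [IsFiniteMeasure ν]
    {G M : Set (E d)} (hG : MeasurableSet G) (hM : MeasurableSet M) (ρ : ℝ) :
    Integrable (G.indicator fun x => ν.real (Metric.ball x ρ ∩ M)) ν ∧
    ∫ x, G.indicator (fun x => ν.real (Metric.ball x ρ ∩ M)) x ∂ν =
      ∫ x, M.indicator (fun x => ν.real (Metric.ball x ρ ∩ G)) x ∂ν := by
  have hT : MeasurableSet {p : E d × E d | p.1 ∈ G ∧ p.2 ∈ M ∧ dist p.1 p.2 < ρ} :=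
    (measurable_fst hG).inter ((measurable_snd hM).inter
      (measurableSet_lt (measurable_fst.dist measurable_snd) measurable_const))
  have h1 : (G.indicator fun x => ν.real (Metric.ball x ρ ∩ M)) = fun x => ν.real {u | (x, u) ∈
      {p : E d × E d | p.1 ∈ G ∧ p.2 ∈ M ∧ dist p.1 p.2 < ρ}} := by
    funext x
    by_cases hx : x ∈ G
    · simp only [Set.indicator_of_mem hx, Set.mem_ofPred_eq, hx, true_and]
      congr 1; ext u; simp [and_comm, dist_comm]
    · simp [hx]
  have h2 : (M.indicator fun x => ν.real (Metric.ball x ρ ∩ G)) = fun u => ν.real {x | (x, u) ∈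
      {p : E d × E d | p.1 ∈ G ∧ p.2 ∈ M ∧ dist p.1 p.2 < ρ}} := by
    funext u
    by_cases hu : u ∈ M
    · simp only [Set.indicator_of_mem hu, Set.mem_ofPred_eq, hu, true_and]
      congr 1; ext x; simp [and_comm]
    · simp [hu]
  rw [h1, h2]
  exact ⟨integrable_measureReal_section hT, integral_measureReal_section_swap hT⟩

/-- A dominating function `g` suffices for the contraction estimate, so measurability of the weight
after an addition is never needed. -/
theorem exists_weight_addAt_le (hΛ : MeasurableSet Λ) (hτ : MeasurableSet τ)
    (hfin : volume Λ ≠ ∞) {α : ℝ} (hα : 0 ≤ α) (X Y : Config Λ τ) :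
    ∃ g : E d → ℝ, Integrable g (volume.restrict Λ) ∧
      (∀ x, weight α (addAt X x) (addAt Y x) ≤ g x) ∧
      ∫ x in Λ, g x ≤ volume.real Λ * weight α X Y + α *
        (volume.restrict (allowed Λ τ)).real (blocked X.centers ∆ blocked Y.centers) := by
  have : IsFiniteMeasure (volume.restrict Λ) := ⟨by simpa using hfin.lt_top⟩
  have hL := measurableSet_allowed hΛ hτ
  set ν := volume.restrict (allowed Λ τ) with hν
  have : IsFiniteMeasure ν :=
    ⟨by simpa [hν] using (measure_mono allowed_subset).trans_lt hfin.lt_top⟩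
  set M := blocked X.centers ∆ blocked Y.centers with hM
  set G := (blocked X.centers ∪ blocked Y.centers)ᶜ with hG
  have hMm : MeasurableSet M := (measurableSet_blocked _).symmDiff (measurableSet_blocked _)
  have hGm : MeasurableSet G := ((measurableSet_blocked _).union (measurableSet_blocked _)).compl
  have hres : ∀ f : E d → ℝ, ∫ x in Λ, (allowed Λ τ).indicator f x = ∫ x, f x ∂ν := by
    intro f
    rw [setIntegral_indicator hL, Set.inter_eq_right.2 allowed_subset]
  have hint : ∀ f : E d → ℝ, Integrable f ν →
      Integrable ((allowed Λ τ).indicator f) (volume.restrict Λ) := by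
    intro f hf
    rw [integrable_indicator_iff hL, IntegrableOn, Measure.restrict_restrict hL,
      Set.inter_eq_left.2 allowed_subset]
    exact hf
  obtain ⟨iG, hswap⟩ := integral_indicator_measureReal_ball_inter_comm (ν := ν) hGm hMm
    (2 * radius d)
  obtain ⟨iM, -⟩ := integral_indicator_measureReal_ball_inter_comm (ν := ν) hMm hGm
    (2 * radius d)
  have i1 : Integrable (M.indicator fun _ => (1 : ℝ)) ν := (integrable_const _).indicator hMm
  have h1 : ∫ x, M.indicator (fun _ => (1 : ℝ)) x ∂ν = ν.real M := integral_indicator_one hMm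
  have jG := hint _ iG
  have jM := hint _ iM
  have j1 := hint _ i1
  have jc : Integrable (fun _ : E d => weight α X Y) (volume.restrict Λ) := integrable_const _
  have jc1 : Integrable (fun x => weight α X Y + α * (allowed Λ τ).indicator
      (M.indicator fun _ => (1 : ℝ)) x) (volume.restrict Λ) := jc.add (j1.const_mul α)
  have jc2 : Integrable (fun x => (weight α X Y + α * (allowed Λ τ).indicator
      (M.indicator fun _ => (1 : ℝ)) x) + (allowed Λ τ).indicator
        (M.indicator fun x => ν.real (Metric.ball x (2 * radius d) ∩ G)) x)
      (volume.restrict Λ) := jc1.add jM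
  refine ⟨fun x => ((weight α X Y + α * (allowed Λ τ).indicator (M.indicator fun _ => (1 : ℝ)) x) +
      (allowed Λ τ).indicator
        (M.indicator fun x => ν.real (Metric.ball x (2 * radius d) ∩ G)) x) -
      (allowed Λ τ).indicator
        (G.indicator fun x => ν.real (Metric.ball x (2 * radius d) ∩ M)) x,
    jc2.sub jG, fun x => ?_, ?_⟩
  · have h2 := card_symmDiff_addAt_le X Y x
    have h3 := measureReal_blocked_addAt_le (ν := ν) X Y x
    have h4 := mul_le_mul_of_nonneg_left h2 hα
    rw [weight, weight]
    rw [← hM, ← hG] at h3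
    rw [← hM] at h4 ⊢
    rw [← hν]
    linarith
  · rw [integral_sub jc2 jG, integral_add jc1 jM, integral_add jc (j1.const_mul α),
      integral_const_mul, hres, hres, hres, hswap, h1, integral_const]
    simp

end Addition

/-! ### One-step contraction of Lipschitz constants. -/

section Contraction

variable {d : ℕ} {Λ τ : Set (E d)}

theorem measurable_removeAt_right (X : Config Λ τ) : Measurable fun x : E d => removeAt X x :=
  Measurable.of_uncurry_left (f := removeAt) measurable_removeAt

theorem measurable_addAt_right (hΛ : MeasurableSet Λ) (hτ : MeasurableSet τ) (X : Config Λ τ) :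
    Measurable fun x : E d => addAt X x :=
  Measurable.of_uncurry_left (f := addAt) (measurable_addAt hΛ hτ)

theorem integrable_of_mem_Icc {S : Type*} [MeasurableSpace S] {μ : Measure S} [IsFiniteMeasure μ]
    {f : S → ℝ} (hf : Measurable f) (h01 : ∀ x, f x ∈ Set.Icc (0 : ℝ) 1) : Integrable f μ :=
  Integrable.of_bound (C := 1) hf.aestronglyMeasurable (ae_of_all _ fun x => by
    rw [Real.norm_of_nonneg (h01 x).1]; exact (h01 x).2)

theorem integral_stepLaw (hΛ : MeasurableSet Λ) (hτ : MeasurableSet τ) (h0 : volume Λ ≠ 0)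
    (hfin : volume Λ ≠ ∞) (lam : ℝ≥0) {f : Config Λ τ → ℝ} (hf : Measurable f)
    (h01 : ∀ X, f X ∈ Set.Icc (0 : ℝ) 1) (X : Config Λ τ) :
    ∫ Z, f Z ∂(stepLaw lam X) = ((1 + lam) * volume.real Λ)⁻¹ *
      ((∫ x in Λ, f (removeAt X x)) + lam * ∫ x in Λ, f (addAt X x)) := by
  have : IsProbabilityMeasure (volume[|Λ]) := cond_isProbabilityMeasure_of_finite h0 hfin
  have hr := measurable_removeAt_right X
  have ha := measurable_addAt_right hΛ hτ X
  have : IsProbabilityMeasure ((volume[|Λ]).map fun x => removeAt X x) :=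
    Measure.isProbabilityMeasure_map hr.aemeasurable
  have : IsProbabilityMeasure ((volume[|Λ]).map fun x => addAt X x) :=
    Measure.isProbabilityMeasure_map ha.aemeasurable
  rw [stepLaw, integral_add_measure
    ((integrable_of_mem_Icc hf h01).smul_measure ENNReal.coe_ne_top)
    ((integrable_of_mem_Icc hf h01).smul_measure ENNReal.coe_ne_top),
    integral_smul_measure, integral_smul_measure,
    integral_map hr.aemeasurable hf.aestronglyMeasurable,
    integral_map ha.aemeasurable hf.aestronglyMeasurable, ProbabilityTheory.cond,
    integral_smul_measure, integral_smul_measure]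
  simp only [ENNReal.coe_toReal, ENNReal.toReal_inv, smul_eq_mul, measureReal_def]
  push_cast
  rw [mul_inv]
  ring

/-- The coupling in dual form: sharing `x` and the coin amounts to comparing the integrands of
`integral_stepLaw` pointwise, so no joint law has to be built. The hypotheses on `γ` say that it is
at most the relative drift of each of the two terms of `weight`. -/
theorem abs_integral_stepLaw_sub_le (hd : 1 ≤ d) (hΛ : MeasurableSet Λ) (hτ : MeasurableSet τ)
    (h0 : volume Λ ≠ 0) (hfin : volume Λ ≠ ∞) (lam : ℝ≥0) {α γ C : ℝ} (hα : 0 ≤ α) (hC : 0 ≤ C)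
    (hγ1 : γ * α ≤ α - 2 ^ d) (hγ2 : γ ≤ 2 - α * lam)
    {f : Config Λ τ → ℝ} (hf : Measurable f) (h01 : ∀ X, f X ∈ Set.Icc (0 : ℝ) 1)
    (hfC : ∀ X Y, |f X - f Y| ≤ C * weight α X Y) (X Y : Config Λ τ) :
    |∫ Z, f Z ∂(stepLaw lam X) - ∫ Z, f Z ∂(stepLaw lam Y)| ≤
      C * Real.exp (-(γ / (1 + lam) / volume.real Λ)) * weight α X Y := by
  have : IsFiniteMeasure (volume.restrict Λ) := ⟨by simpa using hfin.lt_top⟩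
  have hn : 0 < volume.real Λ := ENNReal.toReal_pos h0 hfin
  have hlam : (0 : ℝ) ≤ lam := lam.2
  rw [integral_stepLaw hΛ hτ h0 hfin lam hf h01, integral_stepLaw hΛ hτ h0 hfin lam hf h01]
  obtain ⟨hri, hr⟩ := integral_weight_removeAt_le hd hfin α X Y
  obtain ⟨g, hgi, hg, hgle⟩ := exists_weight_addAt_le hΛ hτ hfin hα X Y
  have irem : ∀ Z : Config Λ τ, Integrable (fun x => f (removeAt Z x)) (volume.restrict Λ) :=
    fun Z => integrable_of_mem_Icc (hf.comp (measurable_removeAt_right Z)) fun _ => h01 _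
  have iadd : ∀ Z : Config Λ τ, Integrable (fun x => f (addAt Z x)) (volume.restrict Λ) :=
    fun Z => integrable_of_mem_Icc (hf.comp (measurable_addAt_right hΛ hτ Z)) fun _ => h01 _
  have hrem : |(∫ x in Λ, f (removeAt X x)) - ∫ x in Λ, f (removeAt Y x)| ≤
      C * ∫ x in Λ, weight α (removeAt X x) (removeAt Y x) := by
    rw [← integral_sub (irem X) (irem Y), ← integral_const_mul]
    exact norm_integral_le_of_norm_le (f := fun x => f (removeAt X x) - f (removeAt Y x))
      (hri.const_mul C) (ae_of_all _ fun x => hfC _ _)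
  have hadd : |(∫ x in Λ, f (addAt X x)) - ∫ x in Λ, f (addAt Y x)| ≤ C * ∫ x in Λ, g x := by
    rw [← integral_sub (iadd X) (iadd Y), ← integral_const_mul]
    exact norm_integral_le_of_norm_le (f := fun x => f (addAt X x) - f (addAt Y x))
      (hgi.const_mul C) (ae_of_all _ fun x =>
      (hfC _ _).trans (mul_le_mul_of_nonneg_left (hg x) hC))
  set D : ℝ := ((X.centers ∆ Y.centers).card : ℝ) with hD
  set M := (volume.restrict (allowed Λ τ)).real (blocked X.centers ∆ blocked Y.centers) with hM
  have hw : weight α X Y = α * D + M := rfl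
  have hD0 : 0 ≤ D := Nat.cast_nonneg _
  have hM0 : 0 ≤ M := measureReal_nonneg
  have hw0 : 0 ≤ weight α X Y := by rw [hw]; positivity
  -- The drifts add up to `-(α - 2 ^ d) D - (2 - α λ) M`, which is at most `-γ (α D + M)`.
  have hdrift : (∫ x in Λ, weight α (removeAt X x) (removeAt Y x)) + lam * ∫ x in Λ, g x ≤
      ((1 + lam) * volume.real Λ - γ) * weight α X Y := by
    have h1 := mul_le_mul_of_nonneg_left hgle hlam
    have h2 := mul_le_mul_of_nonneg_right hγ1 hD0
    have h3 := mul_le_mul_of_nonneg_right hγ2 hM0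
    have h4 : γ * weight α X Y = γ * α * D + γ * M := by rw [hw]; ring
    linarith
  have hp : 0 < (1 + lam) * volume.real Λ := by positivity
  rw [← mul_sub, abs_mul, abs_of_nonneg (by positivity : 0 ≤ ((1 + lam) * volume.real Λ)⁻¹)]
  calc _ ≤ ((1 + lam) * volume.real Λ)⁻¹ *
        (C * (((1 + lam) * volume.real Λ - γ) * weight α X Y)) := by
        refine mul_le_mul_of_nonneg_left ?_ (by positivity)
        refine le_trans ?_ (mul_le_mul_of_nonneg_left hdrift hC)
        rw [add_sub_add_comm, ← mul_sub]
        refine (abs_add_le _ _).trans ?_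
        rw [abs_mul, abs_of_nonneg hlam, mul_add]
        have := mul_le_mul_of_nonneg_left hadd hlam
        linarith
    _ = C * (1 - γ / (1 + lam) / volume.real Λ) * weight α X Y := by
        field_simp
    _ ≤ _ := by
        refine mul_le_mul_of_nonneg_right (mul_le_mul_of_nonneg_left ?_ hC) hw0
        exact Real.one_sub_le_exp_neg _

theorem weight_le (hd : 1 ≤ d) (hfin : volume Λ ≠ ∞) {α : ℝ} (hα : 0 ≤ α) (X Y : Config Λ τ) :
    weight α X Y ≤ (2 * α + 1) * volume.real Λ := by
  have : IsFiniteMeasure (volume.restrict (allowed Λ τ)) :=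
    ⟨by simpa using (measure_mono allowed_subset).trans_lt hfin.lt_top⟩
  have h1 : ((X.centers ∆ Y.centers).card : ℝ) ≤ 2 * volume.real Λ := by
    have h : ((X.centers ∆ Y.centers).card : ℝ) ≤ X.centers.card + Y.centers.card := by
      exact_mod_cast (Finset.card_le_card symmDiff_le_sup).trans (Finset.card_union_le _ _)
    linarith [X.card_le hd hfin, Y.card_le hd hfin]
  have h2 : (volume.restrict (allowed Λ τ)).real (blocked X.centers ∆ blocked Y.centers) ≤
      volume.real Λ := by
    refine (measureReal_mono (Set.subset_univ _)).trans ?_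
    rw [measureReal_restrict_apply_univ]
    exact measureReal_mono allowed_subset hfin
  have h3 := mul_le_mul_of_nonneg_left h1 hα
  rw [weight]
  linarith

/-- Such a region has no room for a center. The case is separated because rounding the number of
steps costs a factor up to `exp (c / n)`, which is unbounded for small `n`. -/
theorem weight_eq_zero_of_volume_lt_one (hd : 1 ≤ d) (hfin : volume Λ ≠ ∞)
    (h1 : volume.real Λ < 1) (α : ℝ) (X Y : Config Λ τ) : weight α X Y = 0 := by
  have h : ∀ Z : Config Λ τ, Z.centers = ∅ := fun Z => by
    have := (Z.card_le hd hfin).trans_lt h1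
    rw [← Finset.card_eq_zero]
    exact Nat.lt_one_iff.1 (by exact_mod_cast this)
  simp [weight, h]

/-- Distinct configurations differ in at least one center and hence have distance at least `α`; this
starts the iteration for arbitrary events. -/
theorem abs_indicator_sub_le (A : Set (Config Λ τ)) {α : ℝ} (hα : 0 < α) (X Y : Config Λ τ) :
    |A.indicator (fun _ => (1 : ℝ)) X - A.indicator (fun _ => (1 : ℝ)) Y| ≤
      α⁻¹ * weight α X Y := by
  have hM0 : 0 ≤ (volume.restrict (allowed Λ τ)).real
    (blocked X.centers ∆ blocked Y.centers) := measureReal_nonneg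
  have hw : ((X.centers ∆ Y.centers).card : ℝ) ≤ α⁻¹ * weight α X Y := by
    rw [weight, mul_add, inv_mul_cancel_left₀ hα.ne']
    have := mul_nonneg (inv_nonneg.2 hα.le) hM0
    linarith
  refine le_trans ?_ hw
  by_cases hXY : X = Y
  · simp [hXY]
  · have : 1 ≤ ((X.centers ∆ Y.centers).card : ℝ) := by
      have : (X.centers ∆ Y.centers).Nonempty := by
        rw [Finset.nonempty_iff_ne_empty]
        exact fun h => hXY (Config.ext (symmDiff_eq_bot.1 h))
      exact_mod_cast this.card_pos
    refine le_trans ?_ this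
    by_cases hX : X ∈ A <;> by_cases hY : Y ∈ A <;> simp [hX, hY]

end Contraction

/-! ### Markov operators and total variation. -/

section MarkovChain

variable {S Ω : Type*} [MeasurableSpace S] [MeasurableSpace Ω]

/-- The Markov operator of a kernel, acting on functions. -/
noncomputable def markovOp (κ : Kernel S S) (f : S → ℝ) : S → ℝ := fun x => ∫ y, f y ∂(κ x)

theorem measurable_markovOp (κ : Kernel S S) {f : S → ℝ} (hf : Measurable f) :
    Measurable (markovOp κ f) :=
  (StronglyMeasurable.integral_kernel hf.stronglyMeasurable).measurable

theorem markovOp_mem_Icc (κ : Kernel S S) [IsMarkovKernel κ] {f : S → ℝ} (hf : Measurable f)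
    (h01 : ∀ x, f x ∈ Set.Icc (0 : ℝ) 1) (x : S) : markovOp κ f x ∈ Set.Icc (0 : ℝ) 1 := by
  refine ⟨integral_nonneg fun y => (h01 y).1, ?_⟩
  have := integral_mono (μ := κ x) (integrable_of_mem_Icc hf h01) (integrable_const 1)
    fun y => (h01 y).2
  simpa [markovOp] using this

theorem IsMarkovChain.integral_succ {κ : Kernel S S} [IsMarkovKernel κ] {P : Measure Ω}
    [IsProbabilityMeasure P] {X : ℕ → Ω → S} (hX : IsMarkovChain κ P X) {f : S → ℝ}
    (hf : Measurable f) (h01 : ∀ x, f x ∈ Set.Icc (0 : ℝ) 1) (t : ℕ) :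
    ∫ ω, f (X (t + 1) ω) ∂P = ∫ ω, markovOp κ f (X t ω) ∂P := by
  set hist : Ω → (Finset.Iic t → S) := fun ω i => X i ω with hhist
  have hm : Measurable hist := measurable_pi_lambda _ fun i => hX.measurable i
  have : IsProbabilityMeasure (P.map hist) := Measure.isProbabilityMeasure_map hm.aemeasurable
  have hlaw := (hX.hasCondDistrib t).map_eq
  have hpair : Measurable fun ω => (hist ω, X (t + 1) ω) := hm.prodMk (hX.measurable _)
  have hf2 : Measurable fun p : (Finset.Iic t → S) × S => f p.2 := hf.comp measurable_snd
  have h1 : ∫ ω, f (X (t + 1) ω) ∂P =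
      ∫ p, f p.2 ∂(P.map fun ω => (hist ω, X (t + 1) ω)) := by
    rw [integral_map hpair.aemeasurable hf2.aestronglyMeasurable]
  rw [h1, hlaw, Measure.integral_compProd (integrable_of_mem_Icc hf2 fun _ => h01 _)]
  simp only [Kernel.comap_apply]
  rw [integral_map hm.aemeasurable]
  · rfl
  · exact ((measurable_markovOp κ hf).comp (measurable_pi_apply _)).aestronglyMeasurable

theorem IsMarkovChain.integral_eq_iterate {κ : Kernel S S} [IsMarkovKernel κ] {P : Measure Ω}
    [IsProbabilityMeasure P] {X : ℕ → Ω → S} (hX : IsMarkovChain κ P X) (t : ℕ) {f : S → ℝ}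
    (hf : Measurable f) (h01 : ∀ x, f x ∈ Set.Icc (0 : ℝ) 1) :
    ∫ ω, f (X t ω) ∂P = ∫ ω, (markovOp κ)^[t] f (X 0 ω) ∂P := by
  induction t generalizing f with
  | zero => rfl
  | succ t ih =>
    rw [hX.integral_succ hf h01, Function.iterate_succ_apply]
    exact ih (measurable_markovOp κ hf) (markovOp_mem_Icc κ hf h01)

theorem abs_integral_sub_const_le {P : Measure Ω} [IsProbabilityMeasure P] {h : Ω → ℝ}
    (hh : Integrable h P) {B c : ℝ} (hB : ∀ ω, |h ω - c| ≤ B) : |∫ ω, h ω ∂P - c| ≤ B := by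
  have h1 : ∫ ω, h ω ∂P - c = ∫ ω, (h ω - c) ∂P := by
    rw [integral_sub hh (integrable_const c)]; simp
  rw [h1]
  simpa using norm_integral_le_of_norm_le_const (μ := P) (f := fun ω => h ω - c) (ae_of_all _ hB)

/-- The dynamics is moved onto the test function, leaving an average over the initial law. Uniform
oscillation of the iterated indicator therefore covers all initial distributions, and averaging over
the two starting points separately avoids a coupling of the chains. -/
theorem tvDist_map_le {Ω' : Type*} [MeasurableSpace Ω'] {κ : Kernel S S} [IsMarkovKernel κ]
    {P : Measure Ω} {Q : Measure Ω'} [IsProbabilityMeasure P] [IsProbabilityMeasure Q]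
    {X : ℕ → Ω → S} {Y : ℕ → Ω' → S} (hX : IsMarkovChain κ P X) (hY : IsMarkovChain κ Q Y)
    (t : ℕ) {B : ℝ} (hB : ∀ A : Set S, MeasurableSet A → ∀ x y,
      |(markovOp κ)^[t] (A.indicator fun _ => 1) x -
        (markovOp κ)^[t] (A.indicator fun _ => 1) y| ≤ B) :
    tvDist (P.map (X t)) (Q.map (Y t)) ≤ B := by
  have : Nonempty {A : Set S // MeasurableSet A} := ⟨⟨∅, MeasurableSet.empty⟩⟩
  refine ciSup_le fun ⟨A, hA⟩ => ?_
  have hf : Measurable (A.indicator fun _ => (1 : ℝ)) := measurable_const.indicator hA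
  have h01 : ∀ x, A.indicator (fun _ => (1 : ℝ)) x ∈ Set.Icc (0 : ℝ) 1 := fun x => by
    by_cases hx : x ∈ A <;> simp [hx]
  have hiter : ∀ t, Measurable ((markovOp κ)^[t] (A.indicator fun _ => 1)) ∧
      ∀ x, (markovOp κ)^[t] (A.indicator fun _ => 1) x ∈ Set.Icc (0 : ℝ) 1 := by
    intro t
    induction t with
    | zero => exact ⟨hf, h01⟩
    | succ t ih =>
      rw [Function.iterate_succ_apply']
      exact ⟨measurable_markovOp κ ih.1, markovOp_mem_Icc κ ih.1 ih.2⟩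
  have h1 : (P.map (X t)).real A = ∫ ω, (markovOp κ)^[t] (A.indicator fun _ => 1) (X 0 ω) ∂P := by
    rw [← hX.integral_eq_iterate t hf h01, ← integral_map (hX.measurable t).aemeasurable
      hf.aestronglyMeasurable]
    exact (integral_indicator_one hA).symm
  have h2 : (Q.map (Y t)).real A = ∫ ω, (markovOp κ)^[t] (A.indicator fun _ => 1) (Y 0 ω) ∂Q := by
    rw [← hY.integral_eq_iterate t hf h01, ← integral_map (hY.measurable t).aemeasurable
      hf.aestronglyMeasurable]
    exact (integral_indicator_one hA).symm
  rw [h1, h2]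
  refine abs_integral_sub_const_le (integrable_of_mem_Icc
    ((hiter t).1.comp (hX.measurable 0)) fun _ => (hiter t).2 _) fun ω => ?_
  rw [abs_sub_comm]
  refine abs_integral_sub_const_le (integrable_of_mem_Icc
    ((hiter t).1.comp (hY.measurable 0)) fun _ => (hiter t).2 _) fun ω' => ?_
  exact hB A hA _ _

end MarkovChain

/-! ### Iteration and choice of constants. -/

section Mixing

variable {d : ℕ} {Λ τ : Set (E d)}

theorem abs_iterate_markovOp_sub_le (hd : 1 ≤ d) (hΛ : MeasurableSet Λ) (hτ : MeasurableSet τ)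
    (h0 : volume Λ ≠ 0) (hfin : volume Λ ≠ ∞) (lam : ℝ≥0) {α γ : ℝ} (hα : 0 < α)
    (hγ1 : γ * α ≤ α - 2 ^ d) (hγ2 : γ ≤ 2 - α * lam) {A : Set (Config Λ τ)}
    (hA : MeasurableSet A) (t : ℕ) (X Y : Config Λ τ) :
    |(markovOp (singleCenterKernel lam Λ τ hΛ hτ))^[t] (A.indicator fun _ => 1) X -
      (markovOp (singleCenterKernel lam Λ τ hΛ hτ))^[t] (A.indicator fun _ => 1) Y| ≤
      α⁻¹ * Real.exp (-(γ / (1 + lam) / volume.real Λ)) ^ t * weight α X Y := by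
  have := isMarkovKernel_singleCenterKernel lam hΛ hτ h0 hfin
  set κ := singleCenterKernel lam Λ τ hΛ hτ with hκ
  suffices h : Measurable ((markovOp κ)^[t] (A.indicator fun _ => 1)) ∧
      (∀ X, (markovOp κ)^[t] (A.indicator fun _ => 1) X ∈ Set.Icc (0 : ℝ) 1) ∧
      ∀ X Y, |(markovOp κ)^[t] (A.indicator fun _ => 1) X -
        (markovOp κ)^[t] (A.indicator fun _ => 1) Y| ≤
        α⁻¹ * Real.exp (-(γ / (1 + lam) / volume.real Λ)) ^ t * weight α X Y from h.2.2 X Y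
  clear X Y
  induction t with
  | zero =>
    refine ⟨measurable_const.indicator hA, fun X => ?_, fun X Y => ?_⟩
    · by_cases hX : X ∈ A <;> simp [hX]
    · simpa using abs_indicator_sub_le A hα X Y
  | succ t ih =>
    obtain ⟨hm, h01, hl⟩ := ih
    rw [Function.iterate_succ_apply']
    refine ⟨measurable_markovOp κ hm, markovOp_mem_Icc κ hm h01, fun X Y => ?_⟩
    have := abs_integral_stepLaw_sub_le hd hΛ hτ h0 hfin lam hα.le (by positivity) hγ1 hγ2 hm h01
      hl X Y
    rw [pow_succ, ← mul_assoc]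
    exact this

end Mixing

end HardSphere

theorem theorem3 (d : ℕ) (hd : 2 ≤ d) (lam : ℝ≥0) (hlam : (lam : ℝ) < 2 ^ (1 - (d : ℤ))) :
    HardSphere.OptimalTemporalMixing.{u} d lam := by
  open HardSphere in
  have hd1 : 1 ≤ d := by omega
  set V : ℝ := 2 ^ d with hV
  have hV0 : 0 < V := by positivity
  have hlam0 : (0 : ℝ) ≤ lam := lam.2
  have hlV : lam * V < 2 := by
    rw [zpow_sub₀ two_ne_zero, zpow_one, zpow_natCast, lt_div_iff₀ hV0] at hlam
    exact hlam
  have hlV0 : 0 ≤ lam * V := by positivity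
  have hs : 0 < 2 + lam * V := by positivity
  -- For `λ > 0` this is the harmonic mean of the two thresholds `V = 2 ^ d` and `2 / λ`, hence
  -- strictly between them; the formula also covers `λ = 0`, where it gives `2 V`.
  set α : ℝ := 4 * V / (2 + lam * V) with hα
  have hα0 : 0 < α := by positivity
  have hαV : V < α := by
    rw [hα, lt_div_iff₀ hs]
    nlinarith
  have hαl : α * lam < 2 := by
    rw [hα, div_mul_eq_mul_div, div_lt_iff₀ hs]
    linarith
  set γ : ℝ := min ((α - V) / α) (2 - α * lam) with hγ
  have hγ0 : 0 < γ := lt_min (div_pos (by linarith) hα0) (by linarith)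
  have hγ1 : γ * α ≤ α - 2 ^ d := by
    have := min_le_left ((α - V) / α) (2 - α * lam)
    rwa [← hγ, le_div_iff₀ hα0] at this
  have hγ2 : γ ≤ 2 - α * lam := min_le_right _ _
  set c : ℝ := γ / (1 + lam) with hc
  have hc0 : 0 < c := by positivity
  -- The factors are the initial Lipschitz constant, the bound on `weight` per unit volume, and the
  -- loss `exp c` from rounding `s n` down.
  refine ⟨α⁻¹ * (2 * α + 1) * Real.exp c, c, by positivity, hc0, ?_⟩
  intro Λ τ hΛ hτ hvol _ s hs0 Ω₁ Ω₂ _ _ P Q _ _ X Y hX hY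
  have hfin : volume Λ ≠ ∞ := hΛ.measure_lt_top.ne
  have := isMarkovKernel_singleCenterKernel lam hΛ.measurableSet hτ hvol.ne' hfin
  refine tvDist_map_le hX hY _ fun A hA x y => ?_
  refine (abs_iterate_markovOp_sub_le hd1 hΛ.measurableSet hτ hvol.ne' hfin lam hα0 hγ1 hγ2 hA _
    x y).trans ?_
  have hn0 : 0 < volume.real Λ := ENNReal.toReal_pos hvol.ne' hfin
  rcases lt_or_ge (volume.real Λ) 1 with hn | hn
  · rw [weight_eq_zero_of_volume_lt_one hd1 hfin hn, mul_zero]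
    positivity
  -- Rounding down loses less than one step, a factor of at most `exp (c / n)`, and this is at most
  -- `exp c` because `n ≥ 1`.
  · have hexp : Real.exp (-(c / volume.real Λ)) ^ ⌊s * volume.real Λ⌋₊ ≤
        Real.exp c * Real.exp (-c * s) := by
      rw [← Real.exp_nat_mul, ← Real.exp_add, Real.exp_le_exp]
      have h1 : s * volume.real Λ ≤ ⌊s * volume.real Λ⌋₊ + 1 := (Nat.lt_floor_add_one _).le
      have h2 : c / volume.real Λ ≤ c := div_le_self hc0.le hn
      have h3 := mul_le_mul_of_nonneg_right h1 (by positivity : 0 ≤ c / volume.real Λ)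
      have h4 : s * volume.real Λ * (c / volume.real Λ) = c * s := by field_simp
      linarith
    calc _ ≤ α⁻¹ * (Real.exp c * Real.exp (-c * s)) * ((2 * α + 1) * volume.real Λ) := by
          refine mul_le_mul (mul_le_mul_of_nonneg_left hexp (by positivity))
            (weight_le hd1 hfin hα0.le x y) ?_ (by positivity)
          exact add_nonneg (mul_nonneg hα0.le (Nat.cast_nonneg _)) measureReal_nonneg
      _ = _ := by ring
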